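/- All posets are finite. For a poset $P$ let $h_P$ and $w(P)$ be its height and width, i.e. the sizes of a largest chain and of a largest antichain. For $k\ge 0$ let $d_k(P)$ (resp. $c_k(P)$) be the maximum size of a subset of $P$ that is a union of $k$ disjoint, possibly empty, antichains (resp. chains), and for $k\ge1$ put $\mu^P_k=d_k(P)-d_{k-1}(P)$ and $\lambda^P_k=c_k(P)-c_{k-1}(P)$, so that $d_k(P)=\mu_1^P+\dots+\mu_k^P$ and $c_k(P)=\lambda_1^P+\dots+\lambda_k^P$. (By Greene's theorem $\lambda^P$ and $\mu^P$ are conjugate partitions of $|P|$.) Call $P$ $d$-decomposable if it has a partition into antichains $A_1,\dots,A_{h_P}$ with $|A_1\cup\dots\cup A_k|=d_k(P)$ for all $k\le h_P$, and $c$-decomposable if it has a partition into chains $C_1,\dots,C_{w(P)}$ with $|C_1\cup\dots\cup C_k|=c_k(P)$ for all $k\le w(P)$. A unichain in the product poset $P\times Q$ is a chain of the form $\{p\}\times C$ or $C\times\{q\}$; a unichain covering is a family of unichains whose union is $P\times Q$; a semiantichain is a subset of $P\times Q$ no two distinct elements of which lie in a common unichain. A semiantichain is decomposable if it equals $\bigcup_{i=1}^m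 A_i\times B_i$ for pairwise disjoint antichains $A_1,\dots,A_m$ of $P$ and pairwise disjoint antichains $B_1,\dots,B_m$ of $Q$. A unichain covering is quasi-decomposable if, for some covering $\mathcal C$ of $P$ by chains, it is the union over $C\in\mathcal C$ of coverings of $C\times Q$ by $d_{|C|}(Q)$ unichains contained in $C\times Q$. **Theorem.** Suppose that $P$ is both $d$-decomposable and $c$-decomposable and that $Q$ is $d$-decomposable. Then the maximum size of a semiantichain in $P\times Q$ and the minimum size of a unichain covering of $P\times Q$ are equal, and their common value is $$\sum_{i=1}^{\min(h_P,h_Q)}\mu_i^P\mu_i^Q=\sum_{j=1}^{w(P)}d_{\lambda_j^P}(Q).$$ The maximum is attained by a decomposable semiantichain and the minimum by a quasi-decomposable unichain covering. Moreover, $\lambda^P$ and $\mu^P$ are conjugate partitions of $|P|$: they are the row lengths and the column lengths of one Young diagram with $|P|$ boxes. -/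

import Mathlib

namespace SaksWest

section Poset

variable (P : Type*) [PartialOrder P] [Fintype P]

open Classical in
/-- The height `h(P)`: the size of a largest chain. -/
noncomputable def height : ℕ :=
  (Finset.univ.filter fun S : Finset P => IsChain (· ≤ ·) (S : Set P)).sup Finset.card

open Classical in
/-- The width `w(P)`: the size of a largest antichain. -/
noncomputable def width : ℕ :=
  (Finset.univ.filter fun S : Finset P => IsAntichain (· ≤ ·) (S : Set P)).sup Finset.card

variable {P} in
/-- `S` is a `k`-antichain: it decomposes into `k` (possibly empty) disjoint antichains. -/
def IsKAntichain (k : ℕ) (S : Finset P) : Prop :=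
  ∃ A : Fin k → Finset P,
    (∀ i, IsAntichain (· ≤ ·) (A i : Set P)) ∧
    (∀ i j, i ≠ j → Disjoint (A i) (A j)) ∧
    ∀ x, x ∈ S ↔ ∃ i, x ∈ A i

variable {P} in
/-- `S` is a `k`-chain: it is the union of `k` (possibly empty) disjoint chains. -/
def IsKChain (k : ℕ) (S : Finset P) : Prop :=
  ∃ C : Fin k → Finset P,
    (∀ i, IsChain (· ≤ ·) (C i : Set P)) ∧
    (∀ i j, i ≠ j → Disjoint (C i) (C j)) ∧
    ∀ x, x ∈ S ↔ ∃ i, x ∈ C i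

open Classical in
/-- `d_k(P)`: the size of a largest `k`-antichain. -/
noncomputable def d (k : ℕ) : ℕ :=
  (Finset.univ.filter fun S : Finset P => IsKAntichain k S).sup Finset.card

open Classical in
/-- `c_k(P)`: the size of a largest `k`-chain. -/
noncomputable def c (k : ℕ) : ℕ :=
  (Finset.univ.filter fun S : Finset P => IsKChain k S).sup Finset.card

/-- The part `λ_k` (`k ≥ 1`) of the Greene partition, the sequence with
`c_k = λ_1 + ⋯ + λ_k` for all `k`. -/
noncomputable def greeneLam (k : ℕ) : ℕ := c P k - c P (k - 1)

/-- The part `μ_k` (`k ≥ 1`) of the dual Greene partition, the sequence with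
`d_k = μ_1 + ⋯ + μ_k` for all `k`. -/
noncomputable def greeneMu (k : ℕ) : ℕ := d P k - d P (k - 1)

open Classical in
/-- `P` has a partition into antichains `A_1, …, A_h`, where `h = h(P)`, such that
`|A_1 ∪ ⋯ ∪ A_k| = d_k(P)` for each `k`. (`A i` stands for `A_{i+1}`.) -/
def IsDDecomposable : Prop :=
  ∃ A : Fin (height P) → Finset P,
    (∀ i, IsAntichain (· ≤ ·) (A i : Set P)) ∧
    (∀ i j, i ≠ j → Disjoint (A i) (A j)) ∧
    (∀ x, ∃ i, x ∈ A i) ∧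
    ∀ k ≤ height P,
      (Finset.univ.filter fun x : P => ∃ i : Fin (height P), (i : ℕ) < k ∧ x ∈ A i).card = d P k

open Classical in
/-- `P` has a partition into chains `C_1, …, C_w`, where `w = w(P)`, such that
`|C_1 ∪ ⋯ ∪ C_k| = c_k(P)` for each `k`. (`C i` stands for `C_{i+1}`.) -/
def IsCDecomposable : Prop :=
  ∃ C : Fin (width P) → Finset P,
    (∀ i, IsChain (· ≤ ·) (C i : Set P)) ∧
    (∀ i j, i ≠ j → Disjoint (C i) (C j)) ∧
    (∀ x, ∃ i, x ∈ C i) ∧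
    ∀ k ≤ width P,
      (Finset.univ.filter fun x : P => ∃ i : Fin (width P), (i : ℕ) < k ∧ x ∈ C i).card = c P k

end Poset

section Product

variable {P Q : Type*} [PartialOrder P] [PartialOrder Q]

/-- A unichain is a chain of the product order on `P × Q` that has the form
`{p} × C` or `C × {q}`. -/
def IsUnichain (U : Finset (P × Q)) : Prop :=
  IsChain (· ≤ ·) (U : Set (P × Q)) ∧
    ((∃ (p : P) (C : Finset Q), U = {p} ×ˢ C) ∨ ∃ (C : Finset P) (q : Q), U = C ×ˢ {q})

/-- A semiantichain is a set no two distinct elements of which lie in a common unichain. -/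
def IsSemiantichain (S : Finset (P × Q)) : Prop :=
  ∀ x ∈ S, ∀ y ∈ S, x ≠ y → ¬ ∃ U : Finset (P × Q), IsUnichain U ∧ x ∈ U ∧ y ∈ U

/-- A unichain covering of `P × Q` is a family of unichains whose union is `P × Q`. -/
def IsUnichainCovering (F : Finset (Finset (P × Q))) : Prop :=
  (∀ U ∈ F, IsUnichain U) ∧ ∀ x : P × Q, ∃ U ∈ F, x ∈ U

/-- A semiantichain is decomposable if it has the form `A_1 × B_1 ∪ ⋯ ∪ A_m × B_m` for
disjoint antichains `A_1, …, A_m` of `P` and disjoint antichains `B_1, …, B_m` of `Q`. -/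
def IsDecomposableSemiantichain (S : Finset (P × Q)) : Prop :=
  IsSemiantichain S ∧
  ∃ (m : ℕ) (A : Fin m → Finset P) (B : Fin m → Finset Q),
    (∀ i, IsAntichain (· ≤ ·) (A i : Set P)) ∧
    (∀ i j, i ≠ j → Disjoint (A i) (A j)) ∧
    (∀ i, IsAntichain (· ≤ ·) (B i : Set Q)) ∧
    (∀ i j, i ≠ j → Disjoint (B i) (B j)) ∧
    ∀ x : P × Q, x ∈ S ↔ ∃ i, x.1 ∈ A i ∧ x.2 ∈ B i

/-- A unichain covering of `P × Q` is quasi-decomposable if there is a chain covering `𝒞` of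
`P` such that it is the union, over the chains `C ∈ 𝒞`, of coverings of `C × Q` by `d_{|C|}(Q)`
unichains inside `C × Q`. -/
def IsQuasiDecomposableCovering [Fintype Q] (F : Finset (Finset (P × Q))) : Prop :=
  IsUnichainCovering F ∧
  ∃ (𝒞 : Finset (Finset P)) (G : Finset P → Finset (Finset (P × Q))),
    (∀ C ∈ 𝒞, IsChain (· ≤ ·) (C : Set P)) ∧
    (∀ p : P, ∃ C ∈ 𝒞, p ∈ C) ∧
    (∀ C ∈ 𝒞,
      (G C).card = d Q C.card ∧
      (∀ U ∈ G C, IsUnichain U ∧ ∀ x ∈ U, x.1 ∈ C) ∧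
      ∀ x : P × Q, x.1 ∈ C → ∃ U ∈ G C, x ∈ U) ∧
    ∀ U, U ∈ F ↔ ∃ C ∈ 𝒞, U ∈ G C

end Product

end SaksWest

open SaksWest

/-! A unichain meets a semiantichain in at most one point, so every semiantichain is at most as
large as every unichain covering; it suffices to build one of each with equal size. Pairing the
`i`-th antichains of `d`-decompositions of `P` and `Q` gives a semiantichain of size `∑ μ_i^P
μ_i^Q`. For the covering, take the chains `C` of a `c`-decomposition of `P` and split `Q` into
chains `D` with `∑ min(|D|, |C|) ≤ d_{|C|}(Q)`; each `C × D` is a grid, covered by its rows or its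
columns, whichever are fewer. The two totals agree by conjugacy of `λ^P` and `μ^P`.

Two facts carry this. `exists_saturated_partition` (Greene–Kleitman) comes from duality for an
assignment problem whose permutations encode chain partitions and whose potentials encode
`k`-antichains. `d_eq_sum_min_greeneLam` derives conjugacy from it when `P` is `c`-decomposable. -/

namespace SaksWest

/-! ### Integral duality for the assignment problem -/

section Assignment

variable {α : Type*} [Fintype α]

/-- Integral duality for the assignment problem: some permutation is tight for some feasible
potential. -/
theorem exists_perm_tight_potential (w : α → α → ℤ) :
    ∃ (σ : Equiv.Perm α) (u v : α → ℤ),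
      (∀ x y, u x + v y ≤ w x y) ∧ ∀ x, u x + v (σ x) = w x (σ x) := by
  -- Induction on a bound for the total slack along the identity, which feasibility keeps
  -- nonnegative.
  classical
  suffices H : ∀ (n : ℕ) (u v : α → ℤ), (∀ x y, u x + v y ≤ w x y) →
      ∑ x, (w x x - u x - v x) ≤ n → ∃ (σ : Equiv.Perm α) (u v : α → ℤ),
      (∀ x y, u x + v y ≤ w x y) ∧ ∀ x, u x + v (σ x) = w x (σ x) by
    refine H (∑ x, (w x x - -∑ y, |w x y| - 0)).toNat (fun x => -∑ y, |w x y|) 0 ?_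
      (Int.self_le_toNat _)
    intro x y
    have := Finset.single_le_sum (f := fun y => |w x y|) (fun i _ => abs_nonneg _)
      (Finset.mem_univ y)
    have h2 := neg_abs_le (w x y)
    simp only [Pi.zero_apply] at this ⊢
    linarith
  intro n
  induction n with
  | zero =>
    intro u v huv hs
    have h0 : ∀ x ∈ Finset.univ, 0 ≤ w x x - u x - v x := fun x _ => by
      have := huv x x; linarith
    have h1 := (Finset.sum_eq_zero_iff_of_nonneg h0).1
      (le_antisymm (by simpa using hs) (Finset.sum_nonneg h0))
    exact ⟨1, u, v, huv, fun x => by have := h1 x (Finset.mem_univ x); simp; linarith⟩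
  | succ n ih =>
    intro u v huv hs
    by_cases hall : ∀ s : Finset α,
        s.card ≤ (s.biUnion fun x => Finset.univ.filter fun y => u x + v y = w x y).card
    · obtain ⟨f, hf, hft⟩ := (Finset.all_card_le_biUnion_card_iff_exists_injective _).1 hall
      exact ⟨Equiv.ofBijective f (Finite.injective_iff_bijective.1 hf), u, v, huv,
        fun x => by simpa using hft x⟩
    · push Not at hall
      obtain ⟨s, hsN⟩ := hall
      set N := s.biUnion fun x => Finset.univ.filter fun y => u x + v y = w x y with hN
      -- Hungarian step at a Hall violator `s` of the tight graph: only non-tight pairs lose slack,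
      -- and integrality leaves them feasible. The diagonal slack drops by `|s| - |N| ≥ 1`.
      refine ih (fun x => u x + if x ∈ s then 1 else 0) (fun y => v y - if y ∈ N then 1 else 0)
        ?_ ?_
      · intro x y
        have hxy := huv x y
        by_cases hx : x ∈ s
        · by_cases hy : y ∈ N
          · simp only [hx, hy, if_true]; linarith
          · have : u x + v y ≠ w x y := fun h => hy (by
              rw [hN, Finset.mem_biUnion]; exact ⟨x, hx, by simpa using h⟩)
            simp only [hx, hy, if_true, if_false]
            have := lt_of_le_of_ne hxy this
            omega
        · simp only [hx, if_false]
          split_ifs <;> linarith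
      · have e : ∀ x, w x x - (u x + if x ∈ s then (1 : ℤ) else 0) -
            (v x - if x ∈ N then (1 : ℤ) else 0) =
            (w x x - u x - v x) - (if x ∈ s then (1 : ℤ) else 0) +
              (if x ∈ N then (1 : ℤ) else 0) := fun x => by ring
        simp only [e, Finset.sum_add_distrib, Finset.sum_sub_distrib (s := Finset.univ)]
        simp only [Finset.sum_sub_distrib] at hs
        simp only [Finset.sum_boole, Finset.filter_mem_eq_inter, Finset.univ_inter]
        push_cast at hs
        have : (N.card : ℤ) + 1 ≤ s.card := by exact_mod_cast hsN
        linarith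

end Assignment

/-! ### Greene numbers and saturated chain partitions -/

section Greene

variable {P : Type*} [PartialOrder P] [Fintype P]

theorem card_le_d {k : ℕ} {S : Finset P} (hS : IsKAntichain k S) : S.card ≤ d P k := by
  classical
  exact Finset.le_sup (f := Finset.card) (by simpa using hS)

theorem card_le_c {k : ℕ} {S : Finset P} (hS : IsKChain k S) : S.card ≤ c P k := by
  classical
  exact Finset.le_sup (f := Finset.card) (by simpa using hS)

omit [Fintype P] in
theorem isKAntichain_empty (k : ℕ) : IsKAntichain k (∅ : Finset P) :=
  ⟨fun _ => ∅, by simp, by simp, by simp⟩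

omit [Fintype P] in
theorem isKChain_empty (k : ℕ) : IsKChain k (∅ : Finset P) :=
  ⟨fun _ => ∅, by simp, by simp, by simp⟩

theorem exists_card_eq_d (k : ℕ) : ∃ S : Finset P, IsKAntichain k S ∧ S.card = d P k := by
  classical
  obtain ⟨S, hS, h⟩ := Finset.exists_mem_eq_sup
    (Finset.univ.filter fun S : Finset P => IsKAntichain k S)
    ⟨∅, by simpa using isKAntichain_empty k⟩ Finset.card
  exact ⟨S, by simpa using hS, by rw [d, h]⟩

theorem exists_card_eq_c (k : ℕ) : ∃ S : Finset P, IsKChain k S ∧ S.card = c P k := by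
  classical
  obtain ⟨S, hS, h⟩ := Finset.exists_mem_eq_sup
    (Finset.univ.filter fun S : Finset P => IsKChain k S)
    ⟨∅, by simpa using isKChain_empty k⟩ Finset.card
  exact ⟨S, by simpa using hS, by rw [c, h]⟩

theorem d_le_card (k : ℕ) : d P k ≤ Fintype.card P := by
  obtain ⟨S, -, h⟩ := exists_card_eq_d (P := P) k
  exact h ▸ Finset.card_le_univ S

theorem c_le_card (k : ℕ) : c P k ≤ Fintype.card P := by
  obtain ⟨S, -, h⟩ := exists_card_eq_c (P := P) k
  exact h ▸ Finset.card_le_univ S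

omit [Fintype P] in
theorem IsKAntichain.succ {k : ℕ} {S : Finset P} (hS : IsKAntichain k S) :
    IsKAntichain (k + 1) S := by
  obtain ⟨A, h1, h2, h3⟩ := hS
  refine ⟨Fin.cons ∅ A, ?_, ?_, ?_⟩
  · intro i; cases i using Fin.cases <;> simp [h1]
  · intro i j hij
    cases i using Fin.cases <;> cases j using Fin.cases <;> simp_all
  · intro x; simp [Fin.exists_fin_succ, h3]

omit [Fintype P] in
theorem IsKChain.succ {k : ℕ} {S : Finset P} (hS : IsKChain k S) : IsKChain (k + 1) S := by
  obtain ⟨A, h1, h2, h3⟩ := hS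
  refine ⟨Fin.cons ∅ A, ?_, ?_, ?_⟩
  · intro i; cases i using Fin.cases <;> simp [h1]
  · intro i j hij
    cases i using Fin.cases <;> cases j using Fin.cases <;> simp_all
  · intro x; simp [Fin.exists_fin_succ, h3]

theorem d_mono : Monotone (d P) := monotone_nat_of_le_succ fun k => by
  obtain ⟨S, hS, h⟩ := exists_card_eq_d (P := P) k
  exact h ▸ card_le_d hS.succ

theorem c_mono : Monotone (c P) := monotone_nat_of_le_succ fun k => by
  obtain ⟨S, hS, h⟩ := exists_card_eq_c (P := P) k
  exact h ▸ card_le_c hS.succ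

theorem d_zero : d P 0 = 0 := by
  obtain ⟨S, ⟨A, -, -, h⟩, hS⟩ := exists_card_eq_d (P := P) 0
  rw [← hS, Finset.card_eq_zero, Finset.eq_empty_iff_forall_notMem]
  exact fun x hx => ((h x).1 hx).elim fun i _ => i.elim0

theorem c_zero : c P 0 = 0 := by
  obtain ⟨S, ⟨A, -, -, h⟩, hS⟩ := exists_card_eq_c (P := P) 0
  rw [← hS, Finset.card_eq_zero, Finset.eq_empty_iff_forall_notMem]
  exact fun x hx => ((h x).1 hx).elim fun i _ => i.elim0

theorem d_eq_sum_greeneMu (k : ℕ) : d P k = ∑ i ∈ Finset.range k, greeneMu P (i + 1) := by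
  induction k with
  | zero => simp [d_zero]
  | succ k ih =>
    rw [Finset.sum_range_succ, ← ih, greeneMu, Nat.add_sub_cancel]
    have := d_mono (P := P) (Nat.le_add_right k 1)
    omega

theorem c_eq_sum_greeneLam (k : ℕ) : c P k = ∑ i ∈ Finset.range k, greeneLam P (i + 1) := by
  induction k with
  | zero => simp [c_zero]
  | succ k ih =>
    rw [Finset.sum_range_succ, ← ih, greeneLam, Nat.add_sub_cancel]
    have := c_mono (P := P) (Nat.le_add_right k 1)
    omega

/-- The union of the `t` fibres of `f` over `T`, all of them chains, is a `t`-chain. -/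
theorem card_fibres_le_c {ι : Type*} [DecidableEq ι] {f : P → ι}
    (hf : ∀ x y, f x = f y → x ≤ y ∨ y ≤ x) (T : Finset ι) :
    (Finset.univ.filter fun x => f x ∈ T).card ≤ c P T.card := by
  refine card_le_c ⟨fun i => Finset.univ.filter fun x => f x = T.equivFin.symm i, ?_, ?_, ?_⟩
  · intro i x hx y hy _
    simp only [Finset.coe_filter, Finset.mem_univ, true_and, Set.mem_ofPred_eq] at hx hy
    exact hf x y (hx.trans hy.symm)
  · intro i j hij
    rw [Finset.disjoint_left]
    intro x hx hy
    simp only [Finset.mem_filter, Finset.mem_univ, true_and] at hx hy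
    exact hij (T.equivFin.symm.injective (Subtype.ext (hx.symm.trans hy)))
  · intro x
    simp only [Finset.mem_filter, Finset.mem_univ, true_and]
    constructor
    · intro h; exact ⟨T.equivFin ⟨f x, h⟩, by simp⟩
    · rintro ⟨i, hi⟩; rw [hi]; exact (T.equivFin.symm i).2

/-- A permutation yields a chain partition by cutting its cycles at the elements that it does not
increase. -/
theorem exists_chain_partition_of_perm [DecidableEq P] (σ : Equiv.Perm P) :
    ∃ f : P → P, (∀ x y, f x = f y → x ≤ y ∨ y ≤ x) ∧
      (∀ x, ¬ f x < σ (f x)) ∧ ∀ x, σ (f x) = f x → x = f x := by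
  -- `f x` is the end of the increasing run `x < σ x < σ (σ x) < ⋯`. Injectivity of `σ` makes
  -- backward steps unique, so runs with the same end are nested.
  let r : P → P → Prop := fun a b => b < a ∧ σ b = a
  have hr : Relator.RightUnique r := fun a b b' h h' => σ.injective (h.2.trans h'.2.symm)
  have hle : ∀ a b, Relation.ReflTransGen r a b → b ≤ a := fun a b h => by
    induction h with
    | refl => exact le_rfl
    | tail _ h ih => exact h.1.le.trans ih
  have key : ∀ x, ∃ e, Relation.ReflTransGen r e x ∧ ¬ e < σ e := by
    intro x
    induction x using (wellFounded_gt (α := P)).induction with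
    | _ x ih =>
      by_cases h : x < σ x
      · obtain ⟨e, he, h'⟩ := ih (σ x) h
        exact ⟨e, he.tail ⟨h, rfl⟩, h'⟩
      · exact ⟨x, .refl, h⟩
  choose f hf hf' using key
  refine ⟨f, fun x y hxy => ?_, hf', fun x hx => ?_⟩
  · rcases Relation.ReflTransGen.total_of_right_unique hr (hf x) (hxy ▸ hf y) with h | h
    · exact Or.inr (hle _ _ h)
    · exact Or.inl (hle _ _ h)
  · rcases Relation.ReflTransGen.cases_head (hf x) with h | ⟨b, hb, -⟩
    · exact h.symm
    · have : b = f x := σ.injective (hb.2.trans hx.symm)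
      exact absurd hb.1 (this ▸ lt_irrefl _)

/-- The Greene–Kleitman theorem: there is a `k`-saturated chain partition, here given by the
fibres of a map. -/
theorem exists_saturated_partition [DecidableEq P] (k : ℕ) :
    ∃ f : P → P, (∀ x y, f x = f y → x ≤ y ∨ y ≤ x) ∧
      ∑ e, min (Finset.univ.filter fun x => f x = e).card k ≤ d P k := by
  classical
  -- `k = 0` is separate because the diagonal weight `1` below must not exceed `k`.
  rcases Nat.eq_zero_or_pos k with rfl | hk
  · exact ⟨id, fun x y h => Or.inl (le_of_eq h), by simp⟩
  rcases isEmpty_or_nonempty P with hP | hP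
  · exact ⟨id, fun x => hP.elim x, by simp⟩
  -- A fixed point costs `1`, an increasing step is free, and any other step ends a chain and costs
  -- `k`. The cost of `σ` therefore dominates `∑ min(|C|, k)` over its chains.
  let w : P → P → ℤ := fun x y => if x = y then 1 else if x < y then 0 else k
  obtain ⟨σ, u, v, huv, hσ⟩ := exists_perm_tight_potential w
  obtain ⟨f, hf, hf1, hf2⟩ := exists_chain_partition_of_perm σ
  refine ⟨f, hf, ?_⟩
  obtain ⟨y₀, hy₀⟩ := Finite.exists_max v
  have hsum : ∑ x, w x (σ x) = ∑ x, (u x + v x) := by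
    rw [Finset.sum_add_distrib, ← Equiv.sum_comp σ v, ← Finset.sum_add_distrib]
    exact Finset.sum_congr rfl fun x _ => (hσ x).symm
  -- Since `u x + v x ≤ w x x = 1`, the dual value is at most the number of `x` attaining `1`.
  let S : Finset P := Finset.univ.filter fun x => u x + v x = 1
  have hS : ∑ x, (u x + v x) ≤ S.card := by
    rw [Finset.card_filter]
    push_cast
    refine Finset.sum_le_sum fun x _ => ?_
    have := huv x x
    simp only [w, if_true] at this
    split_ifs <;> omega
  have hwk : ∀ x y, w x y ≤ k := fun x y => by
    simp only [w]; split_ifs <;> omega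
  have hSk : IsKAntichain k S := by
    -- The levels of `v` on `S` are antichains: `x < y` with `v x = v y` would give `1 = u x + v y ≤
    -- 0`. From `u x + v y₀ ≤ k` and `u x = 1 - v x`, only the levels `0, …, k - 1` occur.
    refine ⟨fun i => S.filter fun x => v y₀ - v x = (i : ℕ), ?_, ?_, ?_⟩
    · intro i x hx y hy hxy hle
      simp only [S, Finset.coe_filter, Finset.mem_filter, Finset.mem_univ, true_and,
        Set.mem_ofPred_eq] at hx hy
      have := huv x y
      simp only [w, if_neg hxy, if_pos (lt_of_le_of_ne hle hxy)] at this
      omega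
    · intro i j hij
      rw [Finset.disjoint_left]
      intro x hx hy
      simp only [Finset.mem_filter] at hx hy
      exact hij (Fin.ext (by omega))
    · intro x
      simp only [Finset.mem_filter]
      constructor
      · intro hx
        have h1 : u x + v x = 1 := by simpa [S] using hx
        have h2 := huv x y₀
        have h3 := hwk x y₀
        have h4 := hy₀ x
        exact ⟨⟨(v y₀ - v x).toNat, by omega⟩, hx, by simp; omega⟩
      · rintro ⟨i, hx, -⟩; exact hx
  have hcost : ∀ e, ((min (Finset.univ.filter fun x => f x = e).card k : ℕ) : ℤ) ≤ w e (σ e) := by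
    intro e
    by_cases h1 : e = σ e
    · have : (Finset.univ.filter fun x => f x = e) ⊆ {e} := by
        intro x hx
        simp only [Finset.mem_filter, Finset.mem_univ, true_and] at hx
        subst hx
        rw [Finset.mem_singleton]
        exact hf2 x h1.symm
      have := Finset.card_le_card this
      simp only [Finset.card_singleton] at this
      simp only [w, if_pos h1]
      omega
    · by_cases h2 : e < σ e
      · have : (Finset.univ.filter fun x => f x = e) = ∅ := by
          rw [Finset.filter_eq_empty_iff]
          rintro x - rfl
          exact hf1 x h2
        simp [this, w, h1, h2]
      · simp only [w, if_neg h1, if_neg h2]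
        omega
  have := Finset.sum_le_sum fun e (_ : e ∈ Finset.univ) => hcost e
  rw [hsum] at this
  have h3 := card_le_d hSk
  have h4 := this.trans hS
  have : ∑ e, min (Finset.univ.filter fun x => f x = e).card k ≤ S.card := by exact_mod_cast h4
  exact this.trans h3

omit [Fintype P] in
theorem card_inter_le_of_isKAntichain [DecidableEq P] {k : ℕ} {S C : Finset P}
    (hS : IsKAntichain k S) (hC : IsChain (· ≤ ·) (C : Set P)) : (C ∩ S).card ≤ k := by
  obtain ⟨A, h1, -, h3⟩ := hS
  have : C ∩ S ⊆ Finset.univ.biUnion fun i => C ∩ A i := by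
    intro x hx
    rw [Finset.mem_inter] at hx
    obtain ⟨i, hi⟩ := (h3 x).1 hx.2
    simp only [Finset.mem_biUnion, Finset.mem_univ, true_and, Finset.mem_inter]
    exact ⟨i, hx.1, hi⟩
  refine (Finset.card_le_card this).trans (Finset.card_biUnion_le.trans ?_)
  refine (Finset.sum_le_card_nsmul _ _ 1 fun i _ => ?_).trans (by simp)
  rw [Finset.card_le_one]
  intro x hx y hy
  rw [Finset.mem_inter] at hx hy
  by_contra hxy
  rcases hC hx.1 hy.1 hxy with h | h
  · exact h1 i hx.2 hy.2 hxy h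
  · exact h1 i hy.2 hx.2 (Ne.symm hxy) h

/-! ### Decomposable posets and conjugacy -/

omit [PartialOrder P] in
open Classical in
/-- The index map of a partition into `B 0, …, B (n - 1)` whose initial unions have the sizes given
by a monotone sequence `F`. -/
theorem exists_index_map {n : ℕ} {B : Fin n → Finset P} {F : ℕ → ℕ}
    (hcov : ∀ x, ∃ i, x ∈ B i) (hdisj : ∀ i j, i ≠ j → Disjoint (B i) (B j))
    (hB : ∀ k ≤ n, (Finset.univ.filter fun x : P => ∃ i : Fin n, (i : ℕ) < k ∧ x ∈ B i).card = F k)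
    (hF : Monotone F) (hF' : ∀ k, F k ≤ Fintype.card P) :
    ∃ f : P → ℕ, (∀ x, f x < n) ∧ (∀ x y, f x = f y → ∃ i, x ∈ B i ∧ y ∈ B i) ∧
      ∀ i, (Finset.univ.filter fun x => f x = i).card = F (i + 1) - F i := by
  choose g hg using hcov
  have huniq : ∀ x i, x ∈ B i → i = g x := fun x i hi => by
    by_contra h
    exact Finset.disjoint_left.1 (hdisj _ _ h) hi (hg x)
  have h1 : ∀ k ≤ n, (Finset.univ.filter fun x : P => (g x : ℕ) < k).card = F k := fun k hk => by
    rw [← hB k hk]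
    congr 1
    ext x
    simp only [Finset.mem_filter, Finset.mem_univ, true_and]
    exact ⟨fun h => ⟨g x, h, hg x⟩, fun ⟨i, hi, hx⟩ => huniq x i hx ▸ hi⟩
  have h2 : ∀ k, (Finset.univ.filter fun x : P => (g x : ℕ) < k).card = F k := fun k => by
    rcases le_total k n with hk | hk
    · exact h1 k hk
    -- Past `n` the sequence `F` stays at `|P|`, so the fibre formula holds for every index, with
    -- empty fibres.
    · have e : ∀ k, n ≤ k → (Finset.univ.filter fun x : P => (g x : ℕ) < k).card =
          Fintype.card P := fun k hk => by
        rw [Finset.filter_true_of_mem fun x _ => (g x).2.trans_le hk, Finset.card_univ]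
      have := h1 n le_rfl
      rw [e n le_rfl] at this
      rw [e k hk]
      exact le_antisymm (this ▸ hF hk) (hF' k)
  refine ⟨fun x => g x, fun x => (g x).2, fun x y h => ⟨g x, hg x, Fin.ext h ▸ hg y⟩, fun i => ?_⟩
  have : (Finset.univ.filter fun x : P => (g x : ℕ) < i + 1) =
      (Finset.univ.filter fun x : P => (g x : ℕ) < i) ∪
        (Finset.univ.filter fun x : P => (g x : ℕ) = i) := by
    rw [← Finset.filter_or]
    exact Finset.filter_congr fun x _ => Nat.lt_succ_iff_lt_or_eq
  rw [← h2, ← h2, this, Finset.card_union_of_disjoint, Nat.add_sub_cancel_left]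
  rw [Finset.disjoint_filter]
  omega

theorem IsDDecomposable.exists_index_map (h : IsDDecomposable P) :
    ∃ f : P → ℕ, (∀ x, f x < height P) ∧ (∀ x y, f x = f y → x ≤ y → x = y) ∧
      ∀ i, (Finset.univ.filter fun x => f x = i).card = greeneMu P (i + 1) := by
  obtain ⟨A, hA, hdisj, hcov, hcard⟩ := h
  obtain ⟨f, h1, h2, h3⟩ := SaksWest.exists_index_map hcov hdisj hcard d_mono d_le_card
  refine ⟨f, h1, fun x y hxy hle => ?_, h3⟩
  obtain ⟨i, hx, hy⟩ := h2 x y hxy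
  by_contra hne
  exact hA i hx hy hne hle

theorem IsCDecomposable.exists_index_map (h : IsCDecomposable P) :
    ∃ f : P → ℕ, (∀ x, f x < width P) ∧ (∀ x y, f x = f y → x ≤ y ∨ y ≤ x) ∧
      ∀ i, (Finset.univ.filter fun x => f x = i).card = greeneLam P (i + 1) := by
  obtain ⟨C, hC, hdisj, hcov, hcard⟩ := h
  obtain ⟨f, h1, h2, h3⟩ := SaksWest.exists_index_map hcov hdisj hcard c_mono c_le_card
  refine ⟨f, h1, fun x y hxy => ?_, h3⟩
  obtain ⟨i, hx, hy⟩ := h2 x y hxy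
  exact (hC i).total hx hy

theorem greeneMu_eq_zero (h : IsDDecomposable P) {i : ℕ} (hi : height P ≤ i) :
    greeneMu P (i + 1) = 0 := by
  obtain ⟨f, h1, -, h3⟩ := h.exists_index_map
  rw [← h3, Finset.card_eq_zero, Finset.filter_eq_empty_iff]
  exact fun x _ hx => by have := h1 x; omega

theorem greeneLam_eq_zero (h : IsCDecomposable P) {i : ℕ} (hi : width P ≤ i) :
    greeneLam P (i + 1) = 0 := by
  obtain ⟨f, h1, -, h3⟩ := h.exists_index_map
  rw [← h3, Finset.card_eq_zero, Finset.filter_eq_empty_iff]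
  exact fun x _ hx => by have := h1 x; omega

theorem sum_greeneLam (h : IsCDecomposable P) :
    ∑ i ∈ Finset.range (width P), greeneLam P (i + 1) = Fintype.card P := by
  obtain ⟨f, h1, -, h3⟩ := h.exists_index_map
  rw [← Finset.card_univ, Finset.card_eq_sum_card_fiberwise (f := f) (t := Finset.range (width P))
    (fun x _ => by simpa using h1 x)]
  exact Finset.sum_congr rfl fun i _ => (h3 i).symm

theorem greeneLam_antitone (h : IsCDecomposable P) : Antitone fun i => greeneLam P (i + 1) := by
  obtain ⟨f, h1, h2, h3⟩ := h.exists_index_map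
  refine antitone_nat_of_succ_le fun i => ?_
  -- The first `i` chains together with the one of index `i + 1`, skipping index `i`, form an `(i +
  -- 1)`-chain.
  have := card_fibres_le_c h2 (insert (i + 1) (Finset.range i))
  rw [Finset.card_insert_of_notMem (by simp), Finset.card_range,
    Finset.card_eq_sum_card_fiberwise (f := f) (t := insert (i + 1) (Finset.range i))
      (fun x hx => by simpa using hx),
    c_eq_sum_greeneLam, Finset.sum_range_succ, Finset.sum_insert (by simp)] at this
  have e : ∀ j ∈ insert (i + 1) (Finset.range i),
      ((Finset.univ.filter fun x => f x ∈ insert (i + 1) (Finset.range i)).filter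
        fun x => f x = j).card = greeneLam P (j + 1) := fun j hj => by
    rw [← h3, Finset.filter_filter]
    congr 1
    exact Finset.filter_congr fun x _ => ⟨fun h => h.2, fun h => ⟨h ▸ hj, h⟩⟩
  rw [e _ (Finset.mem_insert_self _ _),
    Finset.sum_congr rfl fun j hj => e j (Finset.mem_insert_of_mem hj)] at this
  omega

/-- Greene's theorem for a `c`-decomposable poset. -/
theorem d_eq_sum_min_greeneLam (h : IsCDecomposable P) (k : ℕ) :
    d P k = ∑ i ∈ Finset.range (width P), min (greeneLam P (i + 1)) k := by
  classical
  apply le_antisymm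
  · obtain ⟨f, h1, h2, h3⟩ := h.exists_index_map
    obtain ⟨S, hS, hcard⟩ := exists_card_eq_d (P := P) k
    rw [← hcard, Finset.card_eq_sum_card_fiberwise (f := f) (t := Finset.range (width P))
      (fun x _ => by simpa using h1 x)]
    refine Finset.sum_le_sum fun i _ => le_min ?_ ?_
    · rw [← h3]
      exact Finset.card_le_card (Finset.filter_subset_filter _ (Finset.subset_univ _))
    · have := card_inter_le_of_isKAntichain (C := Finset.univ.filter fun x => f x = i) hS
        (fun x hx y hy _ => h2 x y (by simp at hx hy; omega))
      rwa [Finset.filter_inter, Finset.univ_inter] at this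
  · obtain ⟨g, hg, hle⟩ := exists_saturated_partition (P := P) k
    refine le_trans ?_ hle
    set a : P → ℕ := fun e => (Finset.univ.filter fun x => g x = e).card with ha
    -- With `t = |T|` and `n = |P|`, the saturated sum is `t k + (n - ∑_T a) ≥ t k + n - c_t`, while
    -- `∑ min(λ_i, k) ≤ t k + ∑_{i > t} λ_i ≤ t k + n - c_t`.
    set T : Finset P := Finset.univ.filter fun e => k ≤ a e with hT
    have hTc : ∑ e ∈ T, a e ≤ c P T.card := by
      refine le_trans (le_of_eq ?_) (card_fibres_le_c hg T)
      rw [Finset.card_eq_sum_card_fiberwise (f := g) (t := T) (fun x hx => by simpa using hx)]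
      refine Finset.sum_congr rfl fun j hj => ?_
      rw [ha, Finset.filter_filter]
      refine congrArg _ (Finset.filter_congr fun x _ => ⟨fun h => ⟨h ▸ hj, h⟩, fun h => h.2⟩)
    have hn : ∑ e, a e = Fintype.card P := by
      rw [← Finset.card_univ, Finset.card_eq_sum_card_fiberwise (f := g) (t := Finset.univ)
        (fun x _ => by simp)]
    rw [← Finset.sum_filter_add_sum_filter_not _ fun e => k ≤ a e] at hn ⊢
    have h1 : ∑ e ∈ T, min (a e) k = T.card * k := by
      rw [Finset.sum_congr rfl (g := fun _ => k) fun e he => min_eq_right (by simpa [hT] using he),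
        Finset.sum_const, smul_eq_mul]
    have h2 : ∑ e ∈ Finset.univ.filter (fun e => ¬ k ≤ a e), min (a e) k =
        ∑ e ∈ Finset.univ.filter (fun e => ¬ k ≤ a e), a e :=
      Finset.sum_congr rfl fun e he => min_eq_left (by
        simp only [Finset.mem_filter, Finset.mem_univ, true_and] at he; omega)
    -- `t` may exceed the width, so the range is enlarged before splitting at `t`.
    have hM : ∑ i ∈ Finset.range (width P), min (greeneLam P (i + 1)) k ≤
        ∑ i ∈ Finset.range (max (width P) T.card), min (greeneLam P (i + 1)) k :=
      Finset.sum_le_sum_of_subset (Finset.range_mono (le_max_left _ _))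
    have hcM := c_le_card (P := P) (max (width P) T.card)
    rw [← Finset.sum_range_add_sum_Ico _ (le_max_right (width P) T.card)] at hM
    rw [c_eq_sum_greeneLam, ← Finset.sum_range_add_sum_Ico _ (le_max_right (width P) T.card),
      ← c_eq_sum_greeneLam] at hcM
    have h3 : ∑ i ∈ Finset.range T.card, min (greeneLam P (i + 1)) k ≤ T.card * k := by
      simpa using Finset.sum_le_card_nsmul (Finset.range T.card)
        (fun i => min (greeneLam P (i + 1)) k) k fun i _ => min_le_right _ _
    have h4 : ∑ i ∈ Finset.Ico T.card (max (width P) T.card), min (greeneLam P (i + 1)) k ≤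
        ∑ i ∈ Finset.Ico T.card (max (width P) T.card), greeneLam P (i + 1) :=
      Finset.sum_le_sum fun i _ => min_le_left _ _
    change _ ≤ ∑ e ∈ T, min (a e) k + _
    change ∑ e ∈ T, a e + _ = _ at hn
    rw [h1, h2]
    omega

/-- Raising the cap from `k` to `k + 1` increases `min(λ_i, ·)` by one exactly when `λ_i > k`. -/
theorem greeneMu_eq_card (h : IsCDecomposable P) (k : ℕ) :
    greeneMu P (k + 1) =
      ((Finset.range (width P)).filter fun i => k < greeneLam P (i + 1)).card := by
  have : ∀ i, min (greeneLam P (i + 1)) (k + 1) =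
      min (greeneLam P (i + 1)) k + if k < greeneLam P (i + 1) then 1 else 0 := fun i => by
    split_ifs <;> omega
  rw [greeneMu, Nat.add_sub_cancel, d_eq_sum_min_greeneLam h, d_eq_sum_min_greeneLam h,
    Finset.sum_congr rfl fun i _ => this i, Finset.sum_add_distrib, Nat.add_sub_cancel_left,
    Finset.card_filter]

theorem exists_youngDiagram (h : IsCDecomposable P) :
    ∃ G : YoungDiagram, G.card = Fintype.card P ∧
      (∀ j : ℕ, G.rowLen j = greeneLam P (j + 1)) ∧
      ∀ i : ℕ, G.colLen i = greeneMu P (i + 1) := by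
  have hw : ∀ i j, j < greeneLam P (i + 1) → i < width P := fun i j hj => by
    by_contra hi
    rw [greeneLam_eq_zero h (not_lt.1 hi)] at hj
    omega
  let G : YoungDiagram :=
    { cells := (Finset.range (width P) ×ˢ Finset.range (Fintype.card P)).filter
        fun x => x.2 < greeneLam P (x.1 + 1)
      isLowerSet := by
        rintro ⟨a, b⟩ ⟨a', b'⟩ ⟨h1, h2⟩ hx
        have := greeneLam_antitone h h1
        simp only [Finset.coe_filter, Finset.mem_product, Finset.mem_range,
          Set.mem_ofPred_eq] at hx h1 h2 this ⊢
        omega }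
  have hmem : ∀ i j, (i, j) ∈ G ↔ j < greeneLam P (i + 1) := fun i j => by
    rw [← YoungDiagram.mem_cells]
    simp only [G, Finset.mem_filter, Finset.mem_product, Finset.mem_range]
    refine ⟨fun h => h.2, fun hj => ⟨⟨hw i j hj, hj.trans_le ?_⟩, hj⟩⟩
    exact (Nat.sub_le _ _).trans (c_le_card _)
  have hrow : ∀ i, G.rowLen i = greeneLam P (i + 1) := fun i =>
    eq_of_forall_lt_iff fun j => by rw [← YoungDiagram.mem_iff_lt_rowLen, hmem]
  refine ⟨G, ?_, hrow, fun j => ?_⟩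
  · rw [← sum_greeneLam h, YoungDiagram.card, Finset.card_eq_sum_card_fiberwise (f := Prod.fst)
      (t := Finset.range (width P)) (fun x hx => by
        simp only [G, Finset.coe_filter, Finset.mem_product, Set.mem_ofPred_eq] at hx
        exact hx.1.1)]
    refine Finset.sum_congr rfl fun i _ => ?_
    rw [← hrow, YoungDiagram.rowLen_eq_card, YoungDiagram.row]
  · rw [greeneMu_eq_card h, ← Finset.card_range (G.colLen j)]
    congr 1
    ext i
    rw [Finset.mem_filter, Finset.mem_range, Finset.mem_range, ← YoungDiagram.mem_iff_lt_colLen,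
      hmem]
    exact ⟨fun hj => ⟨hw i j hj, hj⟩, fun hj => hj.2⟩

end Greene

/-! ### Semiantichains and unichain coverings of the product -/

section Product

variable {P Q : Type*} [PartialOrder P] [PartialOrder Q]

theorem card_le_card_of_isSemiantichain {S : Finset (P × Q)} {F : Finset (Finset (P × Q))}
    (hS : IsSemiantichain S) (hF : IsUnichainCovering F) : S.card ≤ F.card := by
  choose U hU hxU using hF.2
  refine Finset.card_le_card_of_injOn U (fun x _ => hU x) fun x hx y hy hxy => ?_
  by_contra hne
  exact hS x hx y hy hne ⟨U x, hF.1 _ (hU x), hxU x, hxy ▸ hxU y⟩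

theorem IsUnichain.eq_or_eq {U : Finset (P × Q)} (hU : IsUnichain U) {x y : P × Q} (hx : x ∈ U)
    (hy : y ∈ U) : x.1 = y.1 ∨ x.2 = y.2 := by
  rcases hU.2 with ⟨p, C, rfl⟩ | ⟨C, q, rfl⟩ <;>
    simp only [Finset.mem_product, Finset.mem_singleton] at hx hy
  · exact Or.inl (hx.1.trans hy.1.symm)
  · exact Or.inr (hx.2.trans hy.2.symm)

variable [Fintype P] [Fintype Q]

theorem sum_Icc_one_eq_sum_range (n : ℕ) (f : ℕ → ℕ) :
    ∑ i ∈ Finset.Icc 1 n, f i = ∑ i ∈ Finset.range n, f (i + 1) := by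
  induction n with
  | zero => simp
  | succ n ih => rw [Finset.sum_Icc_succ_top (by omega), ih, Finset.sum_range_succ]

theorem exists_isDecomposableSemiantichain (hP : IsDDecomposable P) (hQ : IsDDecomposable Q) :
    ∃ S : Finset (P × Q), IsDecomposableSemiantichain S ∧
      S.card = ∑ i ∈ Finset.range (min (height P) (height Q)),
        greeneMu P (i + 1) * greeneMu Q (i + 1) := by
  classical
  obtain ⟨f, f1, f2, f3⟩ := hP.exists_index_map
  obtain ⟨g, g1, g2, g3⟩ := hQ.exists_index_map
  refine ⟨Finset.univ.filter fun x => f x.1 = g x.2, ⟨?_, min (height P) (height Q),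
    fun i => Finset.univ.filter fun p => f p = i, fun i => Finset.univ.filter fun q => g q = i,
    ?_, ?_, ?_, ?_, ?_⟩, ?_⟩
  · rintro x hx y hy hne ⟨U, hU, hxU, hyU⟩
    simp only [Finset.mem_filter, Finset.mem_univ, true_and] at hx hy
    -- A shared coordinate forces both indices of `a` and `b` to agree, so in each factor the
    -- coordinates lie in one antichain.
    have key : ∀ a b : P × Q, f a.1 = g a.2 → f b.1 = g b.2 → a.1 = b.1 ∨ a.2 = b.2 → a ≤ b →
        a = b := fun a b ha hb hab hle => by
      have hfg : f a.1 = f b.1 ∧ g a.2 = g b.2 := by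
        rcases hab with h | h <;> rw [h] at ha ⊢ <;> omega
      exact Prod.ext (f2 _ _ hfg.1 hle.1) (g2 _ _ hfg.2 hle.2)
    have hxy := hU.eq_or_eq hxU hyU
    rcases hU.1.total hxU hyU with h | h
    · exact hne (key x y hx hy hxy h)
    · exact hne (key y x hy hx (hxy.imp Eq.symm Eq.symm) h).symm
  · intro i x hx y hy hne hle
    simp only [Finset.coe_filter, Finset.mem_univ, true_and, Set.mem_ofPred_eq] at hx hy
    exact hne (f2 x y (hx.trans hy.symm) hle)
  · intro i j hij
    rw [Finset.disjoint_filter]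
    exact fun x _ hx hy => hij (Fin.ext (hx.symm.trans hy))
  · intro i x hx y hy hne hle
    simp only [Finset.coe_filter, Finset.mem_univ, true_and, Set.mem_ofPred_eq] at hx hy
    exact hne (g2 x y (hx.trans hy.symm) hle)
  · intro i j hij
    rw [Finset.disjoint_filter]
    exact fun x _ hx hy => hij (Fin.ext (hx.symm.trans hy))
  · intro x
    simp only [Finset.mem_filter, Finset.mem_univ, true_and]
    refine ⟨fun h => ⟨⟨f x.1, lt_min (f1 _) (h ▸ g1 _)⟩, rfl, h.symm⟩, ?_⟩
    rintro ⟨i, h1, h2⟩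
    exact h1.trans h2.symm
  · rw [Finset.card_eq_sum_card_fiberwise (f := fun x : P × Q => f x.1)
      (t := Finset.range (min (height P) (height Q)))]
    · refine Finset.sum_congr rfl fun i _ => ?_
      rw [← f3, ← g3, ← Finset.card_product]
      congr 1
      ext x
      simp only [Finset.mem_filter, Finset.mem_univ, true_and, Finset.mem_product]
      exact ⟨fun h => ⟨h.2, h.1.symm.trans h.2⟩, fun h => ⟨h.1.trans h.2.symm, h.1⟩⟩
    · intro x hx
      simp only [Finset.coe_filter, Finset.mem_univ, true_and, Set.mem_ofPred_eq] at hx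
      simpa using ⟨f1 _, hx ▸ g1 _⟩

-- A `|C|`-saturated chain partition of `Q` cuts `C × Q` into grids `C × D`, each needing at most
-- `min(|C|, |D|)` unichains.
omit [Fintype P] in
theorem exists_unichains_cover_chain_prod {C : Finset P} (hC : IsChain (· ≤ ·) (C : Set P)) :
    ∃ G : Finset (Finset (P × Q)), G.card ≤ d Q C.card ∧
      (∀ U ∈ G, IsUnichain U ∧ ∀ x ∈ U, x.1 ∈ C) ∧
      ∀ x : P × Q, x.1 ∈ C → ∃ U ∈ G, x ∈ U := by
  classical
  obtain ⟨f, hf, hle⟩ := exists_saturated_partition (P := Q) C.card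
  let D : Q → Finset Q := fun e => Finset.univ.filter fun q => f q = e
  let G : Q → Finset (Finset (P × Q)) := fun e =>
    if C.card ≤ (D e).card then C.image fun p => {p} ×ˢ D e else (D e).image fun q => C ×ˢ {q}
  refine ⟨Finset.univ.biUnion G, ?_, ?_, ?_⟩
  · refine Finset.card_biUnion_le.trans (le_trans (Finset.sum_le_sum fun e _ => ?_) hle)
    simp only [G]
    split_ifs with h
    · exact Finset.card_image_le.trans (le_min h le_rfl)
    · exact Finset.card_image_le.trans (le_min le_rfl (not_le.1 h).le)
  · intro U hU
    simp only [Finset.mem_biUnion, Finset.mem_univ, true_and, G] at hU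
    obtain ⟨e, hU⟩ := hU
    split_ifs at hU with h
    · obtain ⟨p, hp, rfl⟩ := Finset.mem_image.1 hU
      refine ⟨⟨?_, Or.inl ⟨p, _, rfl⟩⟩, fun x hx => ?_⟩
      · intro x hx y hy _
        simp only [Finset.mem_coe, Finset.mem_product, Finset.mem_singleton, D, Finset.mem_filter,
          Finset.mem_univ, true_and] at hx hy
        have e1 : x.1 = y.1 := hx.1.trans hy.1.symm
        exact (hf _ _ (hx.2.trans hy.2.symm)).imp (fun h => ⟨e1.le, h⟩) (fun h => ⟨e1.ge, h⟩)
      · simp only [Finset.mem_product, Finset.mem_singleton] at hx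
        exact hx.1 ▸ hp
    · obtain ⟨q, hq, rfl⟩ := Finset.mem_image.1 hU
      refine ⟨⟨?_, Or.inr ⟨C, q, rfl⟩⟩, fun x hx => (Finset.mem_product.1 hx).1⟩
      intro x hx y hy _
      simp only [Finset.mem_coe, Finset.mem_product, Finset.mem_singleton] at hx hy
      have e1 : x.2 = y.2 := hx.2.trans hy.2.symm
      exact (hC.total hx.1 hy.1).imp (fun h => ⟨h, e1.le⟩) (fun h => ⟨h, e1.ge⟩)
  · intro x hx
    by_cases h : C.card ≤ (D (f x.2)).card
    · refine ⟨{x.1} ×ˢ D (f x.2), Finset.mem_biUnion.2 ⟨f x.2, Finset.mem_univ _, ?_⟩, by simp [D]⟩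
      simp only [G, if_pos h]
      exact Finset.mem_image.2 ⟨x.1, hx, rfl⟩
    · refine ⟨C ×ˢ {x.2}, Finset.mem_biUnion.2 ⟨f x.2, Finset.mem_univ _, ?_⟩, by simp [hx]⟩
      simp only [G, if_neg h]
      exact Finset.mem_image.2 ⟨x.2, by simp [D], rfl⟩

/-- Double counting: `d_{λ_j}(Q)` is the sum of `μ_i^Q` over `i ≤ λ_j`, and `μ_i^P` counts the `j`
with `λ_j ≥ i`. -/
theorem sum_greeneMu_mul_greeneMu (hPd : IsDDecomposable P) (hPc : IsCDecomposable P)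
    (hQ : IsDDecomposable Q) :
    ∑ i ∈ Finset.range (min (height P) (height Q)), greeneMu P (i + 1) * greeneMu Q (i + 1) =
      ∑ j ∈ Finset.range (width P), d Q (greeneLam P (j + 1)) := by
  set N := Fintype.card P + min (height P) (height Q) with hN
  have h1 : ∑ i ∈ Finset.range (min (height P) (height Q)),
      greeneMu P (i + 1) * greeneMu Q (i + 1) =
      ∑ i ∈ Finset.range N, greeneMu P (i + 1) * greeneMu Q (i + 1) := by
    refine Finset.sum_subset (Finset.range_mono (by omega)) fun i _ hi => ?_
    rw [Finset.mem_range, lt_min_iff, not_and_or, not_lt, not_lt] at hi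
    rcases hi with hi | hi
    · rw [greeneMu_eq_zero hPd hi, zero_mul]
    · rw [greeneMu_eq_zero hQ hi, mul_zero]
  have h2 : ∀ j, d Q (greeneLam P (j + 1)) =
      ∑ i ∈ Finset.range N, if i < greeneLam P (j + 1) then greeneMu Q (i + 1) else 0 := by
    intro j
    rw [d_eq_sum_greeneMu, ← Finset.sum_filter]
    refine Finset.sum_congr ?_ fun _ _ => rfl
    ext i
    have : greeneLam P (j + 1) ≤ Fintype.card P := (Nat.sub_le _ _).trans (c_le_card _)
    simp only [Finset.mem_range, Finset.mem_filter]
    omega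
  rw [h1, Finset.sum_congr rfl fun j _ => h2 j, Finset.sum_comm]
  refine Finset.sum_congr rfl fun i _ => ?_
  rw [greeneMu_eq_card hPc, ← Finset.sum_filter, Finset.sum_const, smul_eq_mul]

/-- The construction only bounds the number of unichains over each chain from above; the
semiantichain `S` of matching size forces equality for every chain. -/
theorem exists_isQuasiDecomposableCovering (hPc : IsCDecomposable P) {S : Finset (P × Q)}
    (hS : IsSemiantichain S)
    (hcard : S.card = ∑ j ∈ Finset.range (width P), d Q (greeneLam P (j + 1))) :
    ∃ F : Finset (Finset (P × Q)), IsQuasiDecomposableCovering F ∧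
      F.card = ∑ j ∈ Finset.range (width P), d Q (greeneLam P (j + 1)) := by
  classical
  obtain ⟨f, f1, f2, f3⟩ := hPc.exists_index_map
  let B : ℕ → Finset P := fun i => Finset.univ.filter fun x => f x = i
  let 𝒞 : Finset (Finset P) := (Finset.range (width P)).image B
  have hchain : ∀ C ∈ 𝒞, IsChain (· ≤ ·) (C : Set P) := by
    intro C hC x hx y hy _
    obtain ⟨i, -, rfl⟩ := Finset.mem_image.1 hC
    simp only [B, Finset.coe_filter, Finset.mem_univ, true_and, Set.mem_ofPred_eq] at hx hy
    exact f2 x y (hx.trans hy.symm)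
  have hcov : ∀ p : P, ∃ C ∈ 𝒞, p ∈ C := fun p =>
    ⟨B (f p), Finset.mem_image_of_mem _ (Finset.mem_range.2 (f1 p)), by simp [B]⟩
  choose! G hGcard hGsub hGcov using fun (C : Finset P) (hC : C ∈ 𝒞) =>
    exists_unichains_cover_chain_prod (Q := Q) (hchain C hC)
  have hF : IsUnichainCovering (𝒞.biUnion G) := by
    refine ⟨fun U hU => ?_, fun x => ?_⟩
    · obtain ⟨C, hC, hU⟩ := Finset.mem_biUnion.1 hU
      exact (hGsub C hC U hU).1
    · obtain ⟨C, hC, hx⟩ := hcov x.1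
      obtain ⟨U, hU, hxU⟩ := hGcov C hC x hx
      exact ⟨U, Finset.mem_biUnion.2 ⟨C, hC, hU⟩, hxU⟩
  have h1 : (𝒞.biUnion G).card ≤ ∑ C ∈ 𝒞, (G C).card := Finset.card_biUnion_le
  have h2 : ∑ C ∈ 𝒞, (G C).card ≤ ∑ C ∈ 𝒞, d Q C.card := Finset.sum_le_sum hGcard
  have h3 : ∑ C ∈ 𝒞, d Q C.card ≤ ∑ j ∈ Finset.range (width P), d Q (greeneLam P (j + 1)) := by
    -- Only an inequality at this point: several indices may give the same (empty) chain.
    refine (Finset.sum_image_le_of_nonneg fun _ _ => Nat.zero_le _).trans (le_of_eq ?_)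
    exact Finset.sum_congr rfl fun j _ => by rw [← f3]
  have h4 := card_le_card_of_isSemiantichain hS hF
  have h5 := (Finset.sum_eq_sum_iff_of_le hGcard).1 (by omega)
  exact ⟨𝒞.biUnion G, ⟨hF, 𝒞, G, hchain, hcov,
    fun C hC => ⟨h5 C hC, hGsub C hC, hGcov C hC⟩, fun U => Finset.mem_biUnion⟩, by omega⟩

end Product

end SaksWest

theorem theorem3 {P Q : Type*} [PartialOrder P] [PartialOrder Q] [Fintype P] [Fintype Q]
    (hPd : IsDDecomposable P) (hPc : IsCDecomposable P) (hQd : IsDDecomposable Q) :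
    -- the maximum size of a semiantichain
    IsGreatest {n : ℕ | ∃ S : Finset (P × Q), IsSemiantichain S ∧ S.card = n}
      (∑ i ∈ Finset.Icc 1 (min (height P) (height Q)),
        greeneMu P i * greeneMu Q i) ∧
    -- the minimum size of a unichain covering is the same number
    IsLeast {n : ℕ | ∃ F : Finset (Finset (P × Q)), IsUnichainCovering F ∧ F.card = n}
      (∑ i ∈ Finset.Icc 1 (min (height P) (height Q)),
        greeneMu P i * greeneMu Q i) ∧
    -- the second expression for this number
    ∑ i ∈ Finset.Icc 1 (min (height P) (height Q)),
        greeneMu P i * greeneMu Q i =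
      ∑ j ∈ Finset.Icc 1 (width P), d Q (greeneLam P j) ∧
    -- the two optima are attained by the two constructions
    (∃ S : Finset (P × Q), IsDecomposableSemiantichain S ∧
      S.card = ∑ i ∈ Finset.Icc 1 (min (height P) (height Q)),
        greeneMu P i * greeneMu Q i) ∧
    (∃ F : Finset (Finset (P × Q)), IsQuasiDecomposableCovering F ∧
      F.card = ∑ j ∈ Finset.Icc 1 (width P), d Q (greeneLam P j)) ∧
    -- `λ^P` and `μ^P` are conjugate partitions of `|P|`: rows and columns of one diagram
    ∃ G : YoungDiagram, G.card = Fintype.card P ∧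
      (∀ j : ℕ, G.rowLen j = greeneLam P (j + 1)) ∧
      ∀ i : ℕ, G.colLen i = greeneMu P (i + 1) := by
  simp only [sum_Icc_one_eq_sum_range]
  have hsum := sum_greeneMu_mul_greeneMu hPd hPc hQd
  obtain ⟨S, hS, hScard⟩ := exists_isDecomposableSemiantichain hPd hQd
  obtain ⟨F, hF, hFcard⟩ := exists_isQuasiDecomposableCovering hPc hS.1 (hScard.trans hsum)
  refine ⟨⟨⟨S, hS.1, hScard⟩, ?_⟩, ⟨⟨F, hF.1, hFcard.trans hsum.symm⟩, ?_⟩, hsum,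
    ⟨S, hS, hScard⟩, ⟨F, hF, hFcard⟩, exists_youngDiagram hPc⟩
  · rintro _ ⟨T, hT, rfl⟩
    rw [hsum, ← hFcard]
    exact card_le_card_of_isSemiantichain hT hF.1
  · rintro _ ⟨E, hE, rfl⟩
    rw [← hScard]
    exact card_le_card_of_isSemiantichain hS.1 hE
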